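/- Let $s,m\ge 1$ be integers and let $p(z)=\sum_{i=0}^{s}p_i z^i$ be a complex polynomial of degree $s$ all of whose roots lie on the unit circle; write its roots, listed with multiplicity, as $z_k=e^{2\pi\imath f_k}$ with $f_k\in\mathbb{R}$, $1\le k\le s$. Let $\mathcal S$ be the space of all two-sided complex sequences $x=(x_t)_{t\in\mathbb Z}$ with $$\sum_{\tau=0}^{s}p_\tau x_{t-\tau}=0\qquad\text{for all } t\in\mathbb Z .$$ Let $$\delta_{\min}=\min_{1\le i\ne j\le s}|f_i-f_j|,$$ where $|f_i-f_j|$ denotes the wrap-around distance on the circle $\mathbb R/\mathbb Z$ of length one, i.e. the distance of $f_i-f_j$ to the nearest integer (and $\delta_{\min}=+\infty$ if $s=1$). Let $u>1$ and suppose that $\delta_{\min}\ge u/m$. Then there exists a filter $\phi=(\phi_\tau)_{\tau\in\mathbb Z}$, $\phi_\tau\in\mathbb C$, with $\phi_\tau=0$ for $\tau\notin[0,m]$, such that $$x_t-[\phi*x]_t=0\quad\text{for every }x\in\mathcal S\text{ and }t\in\mathbb Z,\qquad\text{where } [\phi*x]_t=\sum_{\tau\in\mathbb Z}\phi_\tau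 x_{t-\tau},$$ and $$\|\phi\|_2=\Bigl(\sum_{\tau\in\mathbb Z}|\phi_\tau|^2\Bigr)^{1/2}\le\sqrt{\frac{u+1}{u-1}\cdot\frac{s}{m+1}} .$$ Moreover, if $\delta_{\min}\ge 2/m$, then $\phi$ can be chosen so that in addition $\|\phi\|_2\le\sqrt{3s/(m+1)}$. -/

import Mathlib

open Polynomial
open scoped ENNReal

namespace HarmonicFilter

/-- The right-shift operator on two-sided complex sequences: `[Δ x]_t = x_{t-1}`. -/
def shift : Module.End ℂ (ℤ → ℂ) where
  toFun x := fun t => x (t - 1)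
  map_add' _ _ := rfl
  map_smul' _ _ := rfl

theorem shift_pow_apply (n : ℕ) (x : ℤ → ℂ) (t : ℤ) : (shift ^ n) x t = x (t - n) := by
  induction n generalizing t with
  | zero => simp
  | succ n ih =>
    rw [pow_succ']
    change (shift ^ n) x (t - 1) = _
    rw [ih]
    congr 1
    push_cast
    ring

/-- The space of solutions of the homogeneous linear difference equation `p(Δ) x = 0`. -/
noncomputable def solutionSpace (p : ℂ[X]) : Submodule ℂ (ℤ → ℂ) :=
  LinearMap.ker (aeval shift p)

/-- `x` is a solution iff `∑_{τ ≤ deg p} p_τ x_{t-τ} = 0` for every integer `t`. -/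
theorem mem_solutionSpace (p : ℂ[X]) (x : ℤ → ℂ) :
    x ∈ solutionSpace p ↔
      ∀ t : ℤ, ∑ τ ∈ Finset.range (p.natDegree + 1), p.coeff τ * x (t - τ) = 0 := by
  rw [solutionSpace, LinearMap.mem_ker, aeval_eq_sum_range, funext_iff]
  simp [LinearMap.sum_apply, Finset.sum_apply, shift_pow_apply]

/-- The sequences vanishing outside the integer interval `[k, k']`. -/
def seqOn (k k' : ℤ) : Submodule ℂ (ℤ → ℂ) where
  carrier := {x | ∀ t, t ∉ Set.Icc k k' → x t = 0}
  add_mem' hx hy t ht := by simp [hx t ht, hy t ht]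
  zero_mem' _ _ := rfl
  smul_mem' c x hx t ht := by simp [hx t ht]

/-- The convolution `[u * v]_t = ∑_τ u_τ v_{t-τ}` (used here with `u` of finite support). -/
noncomputable def conv (u v : ℤ → ℂ) : ℤ → ℂ :=
  fun t => ∑' τ : ℤ, u τ * v (t - τ)

/-- The `ℓ₂`-norm of a sequence (used here for sequences of finite support). -/
noncomputable def l2norm (x : ℤ → ℂ) : ℝ :=
  Real.sqrt (∑' t : ℤ, ‖x t‖ ^ 2)

/-- The minimal frequency separation `min_{i ≠ j} |f_i - f_j|`, where `|·|` is the wrap-around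
distance on the circle `ℝ / ℤ` of length one, i.e. the distance of `f_i - f_j` to the nearest
integer. It is `∞` when there is only one frequency, and `0` when a frequency is repeated. -/
noncomputable def minSeparation {s : ℕ} (f : Fin s → ℝ) : ℝ≥0∞ :=
  ⨅ (i : Fin s) (j : Fin s) (_ : i ≠ j),
    ENNReal.ofReal (dist (f i : UnitAddCircle) (f j : UnitAddCircle))

end HarmonicFilter

/-!
If `q` is a polynomial of degree at most `m` with `p ∣ 1 - q`, then its coefficients form a filter
that reproduces the solutions of `p(Δ) x = 0`. The roots `e(f k) = exp(2πi f k)` of `p` are simple,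
so this amounts to interpolating `q(e(f k)) = 1`, and the least-norm interpolant is controlled by a
lower bound for the Gram matrix `V Vᴴ` of the rows of the `s × (m + 1)` Vandermonde matrix
`V = (e(n f k))`, that is, by the dual form of the large sieve inequality.

Summing geometric series gives `V Vᴴ = (m + 1) - (P H P⋆ - Q H Q⋆) / 2`, where `P` and `Q` are
diagonal unitary matrices and `H` has entries `i / sin π(f r - f s)`. Following Montgomery and
Vaughan, `H²` is the sum of a commutator with `H`, whose quadratic form vanishes at the eigenvectors
of `H`, and of a matrix whose absolute row sums are at most `1 / δ²`. So the spectrum of `H` lies in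
`[-1 / δ, 1 / δ]`, and `V Vᴴ ≥ m + 1 - 1 / δ`.
-/

namespace HarmonicFilter

open Finset Matrix
open scoped ComplexOrder MatrixOrder Real FourierTransform

theorem sq_sub_cube_le_sin_sq {x : ℝ} (hx : x ^ 2 ≤ 6) :
    (x - x ^ 3 / 6) ^ 2 ≤ Real.sin x ^ 2 := by
  wlog h0 : 0 ≤ x generalizing x
  · convert this (x := -x) (by simpa using hx) (by linarith) using 1
    · ring
    · simp
  have hpos : 0 ≤ x - x ^ 3 / 6 := by nlinarith
  exact pow_le_pow_left₀ hpos (Real.sin_ge_sub_cube h0) 2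

theorem cos_le_one_sub_sq_add_pow_four {x : ℝ} (hx : x ^ 2 ≤ 24) :
    Real.cos x ≤ 1 - x ^ 2 / 2 + x ^ 4 / 24 := by
  have hsin := sq_sub_cube_le_sin_sq (x := x / 2) (by linarith)
  have hcos : Real.cos x = 1 - 2 * Real.sin (x / 2) ^ 2 := by
    rw [Real.sin_sq_eq_half_sub, mul_div_cancel₀ x two_ne_zero]
    ring
  nlinarith [sq_nonneg (x ^ 3)]

theorem sq_mul_one_add_two_mul_cos_le {x : ℝ} (hx : x ^ 2 ≤ 6) :
    x ^ 2 * (1 + 2 * Real.cos x) ≤ 3 * Real.sin x ^ 2 :=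
  calc x ^ 2 * (1 + 2 * Real.cos x) ≤ x ^ 2 * (1 + 2 * (1 - x ^ 2 / 2 + x ^ 4 / 24)) := by
        gcongr
        exact cos_le_one_sub_sq_add_pow_four (by linarith)
    _ = 3 * (x - x ^ 3 / 6) ^ 2 := by ring
    _ ≤ 3 * Real.sin x ^ 2 :=
        mul_le_mul_of_nonneg_left (sq_sub_cube_le_sin_sq hx) zero_le_three

theorem sin_pi_mul_eq_zero_iff {x : ℝ} : Real.sin (π * x) = 0 ↔ (x : UnitAddCircle) = 0 := by
  simp [Real.sin_eq_zero_iff, AddSubgroup.mem_zmultiples_iff, mul_comm π, Real.pi_ne_zero]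

theorem abs_sin_pi_mul_sub_intCast (x : ℝ) (n : ℤ) :
    |Real.sin (π * (x - n))| = |Real.sin (π * x)| := by
  rw [mul_sub, mul_comm π (n : ℝ), Real.sin_sub_int_mul_pi]
  simp [abs_mul]

theorem abs_cos_pi_mul_sub_intCast (x : ℝ) (n : ℤ) :
    |Real.cos (π * (x - n))| = |Real.cos (π * x)| := by
  rw [mul_sub, mul_comm π (n : ℝ), Real.cos_sub_int_mul_pi]
  simp [abs_mul]

theorem one_add_two_mul_abs_cos_div_sin_sq_le {x : ℝ} (hx : (x : UnitAddCircle) ≠ 0) :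
    (1 + 2 * |Real.cos (π * x)|) / Real.sin (π * x) ^ 2 ≤
      3 / π ^ 2 * (1 / ‖(x : UnitAddCircle)‖ ^ 2) := by
  have hsin : 0 < Real.sin (π * x) ^ 2 := by
    have := sin_pi_mul_eq_zero_iff.not.2 hx
    positivity
  have hnorm : 0 < ‖(x : UnitAddCircle)‖ := norm_pos_iff.2 hx
  rw [UnitAddCircle.norm_eq] at hnorm ⊢
  have hround := abs_sub_round x
  rw [← sq_abs (Real.sin _), ← abs_sin_pi_mul_sub_intCast x (round x), sq_abs] at hsin ⊢
  rw [← abs_cos_pi_mul_sub_intCast x (round x)]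
  set y := x - round x
  have hy : |π * y| ≤ π / 2 := by
    rw [abs_mul, abs_of_pos Real.pi_pos]
    nlinarith [Real.pi_pos]
  have hcos : 0 ≤ Real.cos (π * y) := Real.cos_nonneg_of_mem_Icc (abs_le.1 hy)
  have hsq : (π * y) ^ 2 ≤ 6 := by
    rw [← sq_abs]
    nlinarith [Real.pi_lt_four, Real.pi_pos, abs_nonneg (π * y)]
  have := sq_mul_one_add_two_mul_cos_le hsq
  rw [sq_abs, abs_of_nonneg hcos, div_mul_div_comm, mul_one, div_le_div_iff₀ hsin, ← mul_pow]
  · linarith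
  · rw [← sq_abs y]
    positivity

theorem coe_fourierChar (x : ℝ) : (𝐞 x : ℂ) = Complex.exp (2 * π * Complex.I * x) := by
  rw [Real.fourierChar_apply]
  push_cast
  ring_nf

theorem fourierChar_inj {x y : ℝ} : 𝐞 x = 𝐞 y ↔ (x : UnitAddCircle) = y := by
  rw [← (AddCircle.injective_toCircle one_ne_zero).eq_iff, AddCircle.toCircle_apply_mk,
    AddCircle.toCircle_apply_mk, Real.fourierChar_apply', Real.fourierChar_apply', div_one]

theorem sum_one_div_sq_le_of_le {ι : Type*} {δ : ℝ} (hδ : 0 < δ) {T : Finset ι} {x : ι → ℝ}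
    (hx : ∀ i ∈ T, δ ≤ x i) (hsep : (T : Set ι).Pairwise fun i j => δ ≤ |x i - x j|) :
    ∑ i ∈ T, 1 / x i ^ 2 ≤ π ^ 2 / 6 / δ ^ 2 := by
  classical
  have hone (i) (hi : i ∈ T) : 1 ≤ x i / δ := (one_le_div hδ).2 (hx i hi)
  have hfloor (i) (hi : i ∈ T) : (1 : ℝ) ≤ ⌊x i / δ⌋₊ := by
    exact_mod_cast Nat.one_le_floor_iff _ |>.2 (hone i hi)
  have hinj : Set.InjOn (fun i => ⌊x i / δ⌋₊) T := by
    intro i hi j hj hij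
    by_contra hne
    have hlt : |x i / δ - x j / δ| < 1 := by
      refine Int.abs_sub_lt_one_of_floor_eq_floor ?_
      rw [← Int.natCast_floor_eq_floor (zero_le_one.trans (hone i hi)),
        ← Int.natCast_floor_eq_floor (zero_le_one.trans (hone j hj))]
      exact congrArg Nat.cast hij
    rw [← sub_div, abs_div, abs_of_pos hδ, div_lt_one hδ] at hlt
    exact hlt.not_ge (hsep hi hj hne)
  calc ∑ i ∈ T, 1 / x i ^ 2
      ≤ ∑ i ∈ T, 1 / (⌊x i / δ⌋₊ : ℝ) ^ 2 / δ ^ 2 := by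
        refine sum_le_sum fun i hi => ?_
        have hle : ⌊x i / δ⌋₊ * δ ≤ x i :=
          (le_div_iff₀ hδ).1 (Nat.floor_le (zero_le_one.trans (hone i hi)))
        have := hfloor i hi
        rw [div_div, ← mul_pow]
        gcongr
    _ = (∑ k ∈ T.image fun i => ⌊x i / δ⌋₊, 1 / (k : ℝ) ^ 2) / δ ^ 2 := by
        rw [sum_image hinj, sum_div]
    _ ≤ π ^ 2 / 6 / δ ^ 2 := by
        gcongr
        exact sum_le_hasSum _ (fun k _ => by positivity) hasSum_zeta_two

theorem sum_one_div_sq_le {ι : Type*} {δ : ℝ} (hδ : 0 < δ) {T : Finset ι} {x : ι → ℝ}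
    (hx : ∀ i ∈ T, δ ≤ |x i|) (hsep : (T : Set ι).Pairwise fun i j => δ ≤ |x i - x j|) :
    ∑ i ∈ T, 1 / x i ^ 2 ≤ π ^ 2 / 3 / δ ^ 2 := by
  have hpos : ∑ i ∈ T with 0 ≤ x i, 1 / x i ^ 2 ≤ π ^ 2 / 6 / δ ^ 2 := by
    refine sum_one_div_sq_le_of_le hδ (fun i hi => ?_) (hsep.mono (filter_subset _ T))
    rw [mem_filter] at hi
    simpa only [abs_of_nonneg hi.2] using hx i hi.1
  have hneg : ∑ i ∈ T with ¬ 0 ≤ x i, 1 / (-x i) ^ 2 ≤ π ^ 2 / 6 / δ ^ 2 := by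
    refine sum_one_div_sq_le_of_le hδ (fun i hi => ?_) fun i hi j hj hij => ?_
    · rw [mem_filter, not_le] at hi
      simpa only [abs_of_neg hi.2] using hx i hi.1
    · simpa only [neg_sub_neg, abs_sub_comm] using hsep (mem_filter.1 hi).1 (mem_filter.1 hj).1 hij
  simp only [neg_sq] at hneg
  rw [← sum_filter_add_sum_filter_not T (fun i => 0 ≤ x i)]
  linear_combination hpos + hneg

/-- The points `f i` are `δ`-spaced on the circle `ℝ / ℤ`: distinct indices give points at
wrap-around distance at least `δ`. -/
def IsSeparated {ι : Type*} (δ : ℝ) (f : ι → ℝ) : Prop :=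
  Pairwise fun i j => δ ≤ dist (f i : UnitAddCircle) (f j)

namespace IsSeparated

variable {ι : Type*} {δ : ℝ} {f : ι → ℝ}

theorem le_abs_sub_sub_intCast (h : IsSeparated δ f) {i j : ι} (hij : i ≠ j) (n : ℤ) :
    δ ≤ |f i - f j - n| := by
  refine (h hij).trans ?_
  rw [dist_eq_norm, ← AddCircle.coe_sub, UnitAddCircle.norm_eq]
  exact round_le _ _

theorem injective (h : IsSeparated δ f) (hδ : 0 < δ) :
    Function.Injective fun i => (f i : UnitAddCircle) := by
  intro i j hij
  by_contra hne
  exact (hδ.trans_le (h hne)).ne' (dist_eq_zero.2 hij)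

theorem sum_one_add_two_mul_abs_cos_div_sin_sq_le [Fintype ι] (h : IsSeparated δ f) (hδ : 0 < δ)
    (i : ι) : ∑ j, (1 + 2 * |Real.cos (π * (f i - f j))|) / Real.sin (π * (f i - f j)) ^ 2 ≤
      1 / δ ^ 2 := by
  classical
  let x (j : ι) : ℝ := f i - f j - round (f i - f j)
  have hx : ∑ j ∈ univ.erase i, 1 / x j ^ 2 ≤ π ^ 2 / 3 / δ ^ 2 := by
    refine sum_one_div_sq_le hδ
      (fun j hj => h.le_abs_sub_sub_intCast (ne_of_mem_erase hj).symm _) fun j _ k _ hjk => ?_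
    convert h.le_abs_sub_sub_intCast hjk.symm (round (f i - f j) - round (f i - f k)) using 2
    push_cast
    ring
  calc ∑ j, (1 + 2 * |Real.cos (π * (f i - f j))|) / Real.sin (π * (f i - f j)) ^ 2
      = ∑ j ∈ univ.erase i,
          (1 + 2 * |Real.cos (π * (f i - f j))|) / Real.sin (π * (f i - f j)) ^ 2 := by
        rw [← add_sum_erase _ _ (mem_univ i)]
        simp
    _ ≤ ∑ j ∈ univ.erase i, 3 / π ^ 2 * (1 / x j ^ 2) := by
        refine sum_le_sum fun j hj => ?_
        have hne : ((f i - f j : ℝ) : UnitAddCircle) ≠ 0 := by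
          rw [AddCircle.coe_sub, sub_ne_zero]
          exact (h.injective hδ).ne (ne_of_mem_erase hj).symm
        simpa only [UnitAddCircle.norm_eq, sq_abs] using
          one_add_two_mul_abs_cos_div_sin_sq_le hne
    _ ≤ 3 / π ^ 2 * (π ^ 2 / 3 / δ ^ 2) := by
        rw [← mul_sum]
        gcongr
    _ = 1 / δ ^ 2 := by
        have := Real.pi_ne_zero
        field_simp

end IsSeparated

section CscMatrix

variable {ι : Type*}

theorem inv_sin_mul_inv_sin {a b : ℝ} (ha : Real.sin a ≠ 0) (hb : Real.sin b ≠ 0)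
    (hab : Real.sin (b - a) ≠ 0) :
    (Real.sin a)⁻¹ * (Real.sin b)⁻¹ = (Real.sin (b - a))⁻¹ * (Real.cot a - Real.cot b) := by
  rw [Real.cot_eq_cos_div_sin, Real.cot_eq_cos_div_sin]
  field_simp
  rw [Real.sin_sub]
  ring

/-- The skew-symmetric matrix with entries `1 / sin π(f i - f j)`, the trigonometric analogue of
the matrix of Hilbert's inequality. Its diagonal is `0` because `0⁻¹ = 0`. -/
noncomputable def cscMatrix (f : ι → ℝ) : Matrix ι ι ℝ :=
  of fun i j => (Real.sin (π * (f i - f j)))⁻¹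

/-- The matrix with entries `cot π(f i - f j)`, which governs the partial fractions of products of
entries of `cscMatrix f`. Its diagonal is `0` because `x / 0 = 0`. -/
noncomputable def cotMatrix (f : ι → ℝ) : Matrix ι ι ℝ :=
  of fun i j => Real.cot (π * (f i - f j))

theorem cscMatrix_diag (f : ι → ℝ) (i : ι) : cscMatrix f i i = 0 := by simp [cscMatrix]

theorem cotMatrix_diag (f : ι → ℝ) (i : ι) : cotMatrix f i i = 0 := by
  simp [cotMatrix, Real.cot_eq_cos_div_sin]

theorem cscMatrix_swap (f : ι → ℝ) (i j : ι) : cscMatrix f i j = -cscMatrix f j i := by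
  simp only [cscMatrix, of_apply]
  rw [← neg_sub, mul_neg, Real.sin_neg, inv_neg]

theorem cotMatrix_swap (f : ι → ℝ) (i j : ι) : cotMatrix f i j = -cotMatrix f j i := by
  simp only [cotMatrix, of_apply, Real.cot_eq_cos_div_sin]
  rw [← neg_sub, mul_neg, Real.sin_neg, Real.cos_neg, div_neg]

theorem cscMatrix_mul_cscMatrix_apply [DecidableEq ι] {f : ι → ℝ}
    (hf : Function.Injective fun i => (f i : UnitAddCircle)) {s t : ι} (hst : s ≠ t) (r : ι) :
    cscMatrix f s r * cscMatrix f r t =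
      cscMatrix f s t * (cotMatrix f r t - cotMatrix f r s) -
        ((if r = s then 1 else 0) + if r = t then 1 else 0) *
          (cscMatrix f s t * cotMatrix f s t) := by
  by_cases hrs : r = s
  · subst hrs
    simp [cscMatrix_diag, cotMatrix_diag, hst]
  by_cases hrt : r = t
  · subst hrt
    simp [cscMatrix_diag, cotMatrix_diag, hrs, cotMatrix_swap f r s]
  have hsin {i j : ι} (hij : i ≠ j) : Real.sin (π * (f i - f j)) ≠ 0 := by
    rw [Ne, sin_pi_mul_eq_zero_iff, AddCircle.coe_sub, sub_eq_zero]
    exact hf.ne hij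
  have hsub : π * (f r - f t) - π * (f r - f s) = π * (f s - f t) := by ring
  have hcsc := inv_sin_mul_inv_sin (hsin hrs) (hsin hrt) (by rw [hsub]; exact hsin hst)
  rw [hsub] at hcsc
  rw [cscMatrix_swap f s r, if_neg hrs, if_neg hrt]
  simp only [cscMatrix, cotMatrix, of_apply]
  linear_combination -hcsc

variable [Fintype ι] [DecidableEq ι]

/-- What remains of `-S²`, for `S = cscMatrix f`, after the commutator of `S` with `cotSum f` is
taken out; unlike `S²` itself, it has small entries away from the diagonal. -/
noncomputable def cscDefect (f : ι → ℝ) : Matrix ι ι ℝ :=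
  diagonal (fun s => ∑ r, cscMatrix f s r ^ 2) + (2 : ℝ) • (cscMatrix f ⊙ cotMatrix f)

/-- The diagonal matrix of the column sums of `cotMatrix f`, whose commutator with `cscMatrix f`
absorbs the large part of `cscMatrix f * cscMatrix f`. -/
noncomputable def cotSum (f : ι → ℝ) : Matrix ι ι ℝ :=
  diagonal fun s => ∑ r, cotMatrix f r s

theorem neg_cscMatrix_mul_self {f : ι → ℝ}
    (hf : Function.Injective fun i => (f i : UnitAddCircle)) :
    -(cscMatrix f * cscMatrix f) =
      cotSum f * cscMatrix f - cscMatrix f * cotSum f + cscDefect f := by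
  ext s t
  rw [Matrix.neg_apply, Matrix.add_apply, Matrix.sub_apply, cotSum, diagonal_mul, mul_diagonal,
    cscDefect, Matrix.add_apply, Matrix.smul_apply, hadamard_apply, mul_apply, smul_eq_mul]
  obtain rfl | hst := eq_or_ne s t
  · simp [cscMatrix_diag, cscMatrix_swap f _ s, sq]
  · simp_rw [cscMatrix_mul_cscMatrix_apply hf hst, sum_sub_distrib, ← mul_sum, ← sum_mul,
      sum_add_distrib, sum_sub_distrib, sum_ite_eq', mem_univ, if_true, diagonal_apply_ne _ hst]
    ring

theorem sum_abs_cscDefect_le {f : ι → ℝ} {δ : ℝ} (h : IsSeparated δ f) (hδ : 0 < δ) (s : ι) :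
    ∑ t, |cscDefect f s t| ≤ 1 / δ ^ 2 := by
  have hentry (t : ι) : |cscDefect f s t| ≤
      (if s = t then ∑ r, cscMatrix f s r ^ 2 else 0) +
        2 * |cscMatrix f s t * cotMatrix f s t| := by
    refine (abs_add_le _ _).trans_eq ?_
    have : 0 ≤ ∑ r, cscMatrix f s r ^ 2 := by positivity
    congr 1
    · rw [diagonal_apply]
      split_ifs
      · exact abs_of_nonneg this
      · exact abs_zero
    · simp [abs_mul]
  calc ∑ t, |cscDefect f s t|
      ≤ ∑ t, ((if s = t then ∑ r, cscMatrix f s r ^ 2 else 0) +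
          2 * |cscMatrix f s t * cotMatrix f s t|) := sum_le_sum fun t _ => hentry t
    _ = ∑ t, (1 + 2 * |Real.cos (π * (f s - f t))|) / Real.sin (π * (f s - f t)) ^ 2 := by
      rw [sum_add_distrib, sum_ite_eq, if_pos (mem_univ s), ← sum_add_distrib]
      refine sum_congr rfl fun t _ => ?_
      simp only [cscMatrix, cotMatrix, of_apply, Real.cot_eq_cos_div_sin, abs_mul, abs_div, abs_inv,
        ← sq_abs (Real.sin _)⁻¹]
      rw [← sq_abs (Real.sin _)]
      ring
    _ ≤ 1 / δ ^ 2 := h.sum_one_add_two_mul_abs_cos_div_sin_sq_le hδ s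

end CscMatrix

section LoewnerOrder

variable {𝕜 ι κ : Type*} [RCLike 𝕜] [Fintype ι] [Fintype κ]

theorem star_dotProduct_self (v : ι → 𝕜) : star v ⬝ᵥ v = ((∑ i, ‖v i‖ ^ 2 : ℝ) : 𝕜) := by
  simp [dotProduct, RCLike.conj_mul]

theorem sum_norm_sub_smul_sq (b y : ι → 𝕜) (c : ℝ) :
    ∑ i, ‖b i - c • y i‖ ^ 2 =
      ∑ i, ‖b i‖ ^ 2 - 2 * c * RCLike.re (star y ⬝ᵥ b) + c ^ 2 * ∑ i, ‖y i‖ ^ 2 := by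
  simp only [dotProduct, map_sum, mul_sum, ← sum_sub_distrib, ← sum_add_distrib]
  refine sum_congr rfl fun i _ => ?_
  rw [RCLike.real_smul_eq_coe_smul (K := 𝕜), norm_sub_sq (𝕜 := 𝕜), inner_re_symm,
    inner_smul_real_left, RCLike.smul_re, norm_smul, RCLike.norm_ofReal, mul_pow, sq_abs,
    RCLike.inner_apply', Pi.star_apply, RCLike.star_def, mul_assoc]

theorem star_dotProduct_commutator_mulVec {H : Matrix ι ι 𝕜} (hH : H.IsHermitian)
    {v : ι → 𝕜} {ν : ℝ} (hv : H *ᵥ v = (ν : 𝕜) • v) (A : Matrix ι ι 𝕜) :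
    star v ⬝ᵥ (A * H - H * A) *ᵥ v = 0 := by
  have hv' : star v ᵥ* H = (ν : 𝕜) • star v := by
    simpa [hH.eq, star_mulVec] using congrArg star hv
  rw [sub_mulVec, dotProduct_sub, ← mulVec_mulVec, ← mulVec_mulVec, hv, dotProduct_mulVec _ H, hv',
    mulVec_smul, dotProduct_smul, smul_dotProduct, sub_self]

theorem star_dotProduct_mulVec_mono {A B : Matrix ι ι 𝕜} (h : A ≤ B) (v : ι → 𝕜) :
    star v ⬝ᵥ A *ᵥ v ≤ star v ⬝ᵥ B *ᵥ v := by
  have := (le_iff.1 h).dotProduct_mulVec_nonneg v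
  rwa [sub_mulVec, dotProduct_sub, sub_nonneg] at this

variable [DecidableEq ι]

theorem star_dotProduct_algebraMap_mulVec (c : ℝ) (v : ι → 𝕜) :
    star v ⬝ᵥ algebraMap ℝ (Matrix ι ι 𝕜) c *ᵥ v = ((c * ∑ i, ‖v i‖ ^ 2 : ℝ) : 𝕜) := by
  rw [Algebra.algebraMap_eq_smul_one, smul_mulVec, one_mulVec, dotProduct_smul,
    star_dotProduct_self, RCLike.real_smul_eq_coe_mul, RCLike.ofReal_mul]

theorem hasEigenvalue_toLin'_of_mem_spectrum {A : Matrix ι ι 𝕜} {μ : ℝ}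
    (hμ : μ ∈ spectrum ℝ A) : Module.End.HasEigenvalue (toLin' A) (μ : 𝕜) := by
  rw [Module.End.hasEigenvalue_iff_mem_spectrum, spectrum_toLin']
  exact (spectrum.algebraMap_mem_iff 𝕜).2 hμ

theorem le_algebraMap_of_forall_sum_norm_le {B : Matrix ι ι 𝕜} {c : ℝ} (hB : B.IsHermitian)
    (hc : ∀ i, ∑ j, ‖B i j‖ ≤ c) : B ≤ algebraMap ℝ _ c := by
  rw [le_algebraMap_iff_spectrum_le hB]
  intro μ hμ
  obtain ⟨i, hi⟩ := eigenvalue_mem_ball (hasEigenvalue_toLin'_of_mem_spectrum hμ)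
  rw [mem_closedBall_iff_norm] at hi
  calc μ ≤ ‖(μ : 𝕜)‖ := by simpa only [RCLike.norm_ofReal] using le_abs_self μ
    _ ≤ ‖B i i‖ + ∑ j ∈ univ.erase i, ‖B i j‖ :=
      (norm_le_norm_add_norm_sub' _ _).trans (add_le_add_right hi _)
    _ ≤ c := by
      rw [add_sum_erase _ (fun j => ‖B i j‖) (mem_univ i)]
      exact hc i

theorem sq_le_of_mul_self_eq_commutator_add {H A B : Matrix ι ι 𝕜} {c ν : ℝ}
    (hH : H.IsHermitian) (hHH : H * H = A * H - H * A + B) (hB : B ≤ algebraMap ℝ _ c)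
    (hν : ν ∈ spectrum ℝ H) : ν ^ 2 ≤ c := by
  obtain ⟨v, hv⟩ := (hasEigenvalue_toLin'_of_mem_spectrum hν).exists_hasEigenvector
  have hHv : H *ᵥ v = (ν : 𝕜) • v := hv.apply_eq_smul
  have hle : ((ν ^ 2 * ∑ i, ‖v i‖ ^ 2 : ℝ) : 𝕜) ≤ ((c * ∑ i, ‖v i‖ ^ 2 : ℝ) : 𝕜) :=
    calc ((ν ^ 2 * ∑ i, ‖v i‖ ^ 2 : ℝ) : 𝕜) = star v ⬝ᵥ (H * H) *ᵥ v := by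
          rw [← mulVec_mulVec, hHv, mulVec_smul, hHv, smul_smul, dotProduct_smul, smul_eq_mul,
            star_dotProduct_self, RCLike.ofReal_mul, RCLike.ofReal_pow, sq]
      _ = star v ⬝ᵥ B *ᵥ v := by
          rw [hHH, add_mulVec, dotProduct_add, star_dotProduct_commutator_mulVec hH hHv, zero_add]
      _ ≤ ((c * ∑ i, ‖v i‖ ^ 2 : ℝ) : 𝕜) := by
          rw [← star_dotProduct_algebraMap_mulVec]
          exact star_dotProduct_mulVec_mono hB v
  refine le_of_mul_le_mul_right (RCLike.ofReal_le_ofReal.1 hle) ?_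
  exact RCLike.ofReal_pos.1 (star_dotProduct_self v ▸ dotProduct_star_self_pos_iff.2 hv.2)

theorem exists_mulVec_eq_of_algebraMap_le {V : Matrix ι κ 𝕜} {c : ℝ} (hc : 0 < c)
    (hV : algebraMap ℝ _ c ≤ V * Vᴴ) (b : ι → 𝕜) :
    ∃ a : κ → 𝕜, V *ᵥ a = b ∧ c * ∑ k, ‖a k‖ ^ 2 ≤ ∑ i, ‖b i‖ ^ 2 := by
  have hunit : IsUnit (V * Vᴴ) := by
    have hpos : (algebraMap ℝ (Matrix ι ι 𝕜) c).PosDef := by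
      rw [Algebra.algebraMap_eq_smul_one]
      exact PosDef.one.smul hc
    simpa only [sub_add_cancel] using (PosDef.posSemidef_add (le_iff.1 hV) hpos).isUnit
  obtain ⟨y, rfl⟩ := mulVec_surjective_iff_isUnit.2 hunit b
  refine ⟨Vᴴ *ᵥ y, mulVec_mulVec _ _ _, ?_⟩
  have hself : star y ⬝ᵥ (V * Vᴴ) *ᵥ y = ((∑ k, ‖(Vᴴ *ᵥ y) k‖ ^ 2 : ℝ) : 𝕜) := by
    rw [← star_dotProduct_self, star_mulVec, conjTranspose_conjTranspose, ← dotProduct_mulVec,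
      mulVec_mulVec]
  have hle : c * ∑ i, ‖y i‖ ^ 2 ≤ ∑ k, ‖(Vᴴ *ᵥ y) k‖ ^ 2 := by
    rw [← RCLike.ofReal_le_ofReal (K := 𝕜), ← hself, ← star_dotProduct_algebraMap_mulVec]
    exact star_dotProduct_mulVec_mono hV y
  have hsub : 0 ≤ ∑ i, ‖((V * Vᴴ) *ᵥ y) i - c • y i‖ ^ 2 := by positivity
  rw [sum_norm_sub_smul_sq, hself, RCLike.ofReal_re] at hsub
  nlinarith

end LoewnerOrder

section HilbertMatrix

variable {ι : Type*}

/-- The Hermitian form of `cscMatrix f`, with entries `i / sin π(f r - f s)` off the diagonal and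
`0` on it. -/
noncomputable def hilbertMatrix (f : ι → ℝ) : Matrix ι ι ℂ :=
  Complex.I • (cscMatrix f).map Complex.ofRealHom

theorem hilbertMatrix_apply (f : ι → ℝ) (i j : ι) :
    hilbertMatrix f i j = Complex.I / Real.sin (π * (f i - f j)) := by
  simp [hilbertMatrix, cscMatrix, div_eq_mul_inv]

theorem isHermitian_hilbertMatrix (f : ι → ℝ) : (hilbertMatrix f).IsHermitian := by
  refine IsHermitian.ext fun i j => ?_
  simp [hilbertMatrix, cscMatrix_swap f i j]

variable [Fintype ι] [DecidableEq ι]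

theorem isHermitian_cscDefect (f : ι → ℝ) : (cscDefect f).IsHermitian := by
  refine (isHermitian_diagonal _).add ((IsHermitian.ext fun i j => ?_).smul (IsSelfAdjoint.all _))
  simp [cscMatrix_swap f i j, cotMatrix_swap f i j]

theorem hilbertMatrix_mul_self {f : ι → ℝ}
    (hf : Function.Injective fun i => (f i : UnitAddCircle)) :
    hilbertMatrix f * hilbertMatrix f =
      (-Complex.I • (cotSum f).map Complex.ofRealHom) * hilbertMatrix f -
        hilbertMatrix f * (-Complex.I • (cotSum f).map Complex.ofRealHom) +
        (cscDefect f).map Complex.ofRealHom := by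
  have hmap := congrArg Complex.ofRealHom.mapMatrix (neg_cscMatrix_mul_self hf)
  simp only [map_add, map_sub, map_neg, map_mul, RingHom.mapMatrix_apply] at hmap
  simp only [hilbertMatrix, smul_mul_smul_comm, mul_neg, neg_mul, Complex.I_mul_I, neg_neg,
    one_smul, neg_smul]
  exact hmap

theorem IsSeparated.abs_le_of_mem_spectrum_hilbertMatrix {δ ν : ℝ} {f : ι → ℝ}
    (h : IsSeparated δ f) (hδ : 0 < δ) (hν : ν ∈ spectrum ℝ (hilbertMatrix f)) :
    |ν| ≤ 1 / δ := by
  refine abs_le_of_sq_le_sq ?_ (by positivity)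
  rw [div_pow, one_pow]
  exact sq_le_of_mul_self_eq_commutator_add (isHermitian_hilbertMatrix f)
    (hilbertMatrix_mul_self (h.injective hδ))
    (le_algebraMap_of_forall_sum_norm_le ((isHermitian_cscDefect f).map _ fun _ => by simp)
      fun i => by simpa using sum_abs_cscDefect_le h hδ i) hν

theorem IsSeparated.hilbertMatrix_le {δ : ℝ} {f : ι → ℝ} (h : IsSeparated δ f) (hδ : 0 < δ) :
    hilbertMatrix f ≤ algebraMap ℝ _ (1 / δ) := by
  rw [le_algebraMap_iff_spectrum_le (isHermitian_hilbertMatrix f)]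
  exact fun ν hν => (abs_le.1 (h.abs_le_of_mem_spectrum_hilbertMatrix hδ hν)).2

theorem IsSeparated.le_hilbertMatrix {δ : ℝ} {f : ι → ℝ} (h : IsSeparated δ f) (hδ : 0 < δ) :
    algebraMap ℝ _ (-(1 / δ)) ≤ hilbertMatrix f := by
  rw [algebraMap_le_iff_le_spectrum (isHermitian_hilbertMatrix f)]
  exact fun ν hν => (abs_le.1 (h.abs_le_of_mem_spectrum_hilbertMatrix hδ hν)).1

end HilbertMatrix

section LargeSieve

theorem fourierChar_half_sub_fourierChar_neg_half (x : ℝ) :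
    (𝐞 (x / 2) : ℂ) - 𝐞 (-(x / 2)) = 2 * Complex.I * Real.sin (π * x) := by
  rw [Real.fourierChar_apply, Real.fourierChar_apply, Complex.ofReal_sin, Complex.sin]
  push_cast
  ring_nf
  rw [Complex.I_sq]
  ring_nf

theorem two_mul_I_mul_sin_mul_sum_fourierChar (N : ℕ) (x : ℝ) :
    2 * Complex.I * Real.sin (π * x) * ∑ n ∈ range N, (𝐞 (n * x) : ℂ) =
      𝐞 ((N - 1 / 2) * x) - 𝐞 (-1 / 2 * x) := by
  rw [← fourierChar_half_sub_fourierChar_neg_half, mul_sum]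
  calc ∑ n ∈ range N, ((𝐞 (x / 2) : ℂ) - 𝐞 (-(x / 2))) * 𝐞 (n * x)
      = ∑ n ∈ range N, ((𝐞 (((n + 1 : ℕ) - 1 / 2) * x) : ℂ) - 𝐞 ((n - 1 / 2) * x)) := by
        refine sum_congr rfl fun n _ => ?_
        rw [sub_mul, ← Circle.coe_mul, ← Circle.coe_mul, ← AddChar.map_add_eq_mul,
          ← AddChar.map_add_eq_mul]
        push_cast
        ring_nf
    _ = 𝐞 ((N - 1 / 2) * x) - 𝐞 (-1 / 2 * x) := by
        rw [sum_range_sub (fun n : ℕ => (𝐞 ((n - 1 / 2) * x) : ℂ))]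
        norm_num

variable {ι : Type*}

/-- The rectangular Vandermonde matrix of the nodes `e(f r) = exp(2πi f r)`: it sends the
coefficients of a polynomial of degree less than `N` to its values at the nodes. -/
noncomputable def fourierMatrix (f : ι → ℝ) (N : ℕ) : Matrix ι (Fin N) ℂ :=
  of fun r n => (𝐞 (f r) : ℂ) ^ (n : ℕ)

theorem fourierMatrix_mul_conjTranspose_apply (f : ι → ℝ) (N : ℕ) (r s : ι) :
    (fourierMatrix f N * (fourierMatrix f N)ᴴ) r s =
      ∑ n ∈ range N, (𝐞 (n * (f r - f s)) : ℂ) := by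
  rw [mul_apply, ← Fin.sum_univ_eq_sum_range (fun n => (𝐞 (n * (f r - f s)) : ℂ))]
  refine sum_congr rfl fun n _ => ?_
  rw [conjTranspose_apply, fourierMatrix, of_apply, of_apply, star_pow, RCLike.star_def,
    ← Circle.coe_inv_eq_conj, ← AddChar.map_neg_eq_inv, ← mul_pow, ← Circle.coe_mul,
    ← AddChar.map_add_eq_mul, ← sub_eq_add_neg, ← Circle.coe_pow, ← AddChar.map_nsmul_eq_pow,
    nsmul_eq_mul]

variable [Fintype ι] [DecidableEq ι]

/-- The diagonal unitary matrix with entries `e(c f r)`, where `e(x) = exp(2πix)`; conjugation by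
it multiplies the `(r, s)` entry of a matrix by `e(c (f r - f s))`. -/
noncomputable def phaseMatrix (f : ι → ℝ) (c : ℝ) : Matrix ι ι ℂ :=
  diagonal fun r => (𝐞 (c * f r) : ℂ)

theorem phaseMatrix_mul_mul_star_apply (f : ι → ℝ) (c : ℝ) (M : Matrix ι ι ℂ) (r s : ι) :
    (phaseMatrix f c * M * star (phaseMatrix f c)) r s = 𝐞 (c * (f r - f s)) * M r s := by
  rw [phaseMatrix, star_eq_conjTranspose, diagonal_conjTranspose, mul_diagonal, diagonal_mul,
    mul_right_comm, Pi.star_apply, RCLike.star_def, ← Circle.coe_inv_eq_conj,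
    ← AddChar.map_neg_eq_inv, ← Circle.coe_mul, ← AddChar.map_add_eq_mul, ← sub_eq_add_neg, mul_sub]

theorem phaseMatrix_mul_algebraMap_mul_star (f : ι → ℝ) (c d : ℝ) :
    phaseMatrix f c * algebraMap ℝ _ d * star (phaseMatrix f c) = algebraMap ℝ _ d := by
  ext r s
  rw [phaseMatrix_mul_mul_star_apply, Algebra.algebraMap_eq_smul_one]
  obtain rfl | hrs := eq_or_ne r s
  · simp
  · simp [hrs]

theorem fourierMatrix_mul_conjTranspose {f : ι → ℝ}
    (hf : Function.Injective fun i => (f i : UnitAddCircle)) (N : ℕ) :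
    fourierMatrix f N * (fourierMatrix f N)ᴴ =
      algebraMap ℝ _ (N : ℝ) - (1 / 2 : ℝ) •
        (phaseMatrix f (N - 1 / 2) * hilbertMatrix f * star (phaseMatrix f (N - 1 / 2)) -
          phaseMatrix f (-1 / 2) * hilbertMatrix f * star (phaseMatrix f (-1 / 2))) := by
  ext r s
  rw [fourierMatrix_mul_conjTranspose_apply, Matrix.sub_apply, Matrix.smul_apply, Matrix.sub_apply,
    phaseMatrix_mul_mul_star_apply, phaseMatrix_mul_mul_star_apply, ← sub_mul,
    ← two_mul_I_mul_sin_mul_sum_fourierChar, Algebra.algebraMap_eq_smul_one, Matrix.smul_apply]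
  obtain rfl | hrs := eq_or_ne r s
  · simp
  have hsin : (Real.sin (π * (f r - f s)) : ℂ) ≠ 0 := by
    rw [Complex.ofReal_ne_zero, Ne, sin_pi_mul_eq_zero_iff, AddCircle.coe_sub, sub_eq_zero]
    exact hf.ne hrs
  rw [hilbertMatrix_apply, one_apply_ne hrs, smul_zero, zero_sub, Complex.real_smul]
  generalize ∑ n ∈ range N, (𝐞 (n * (f r - f s)) : ℂ) = S
  generalize (Real.sin (π * (f r - f s)) : ℂ) = c at hsin ⊢
  push_cast
  field_simp
  rw [Complex.I_sq, mul_neg_one, neg_neg]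

theorem IsSeparated.le_fourierMatrix_mul_conjTranspose {f : ι → ℝ} {δ : ℝ}
    (h : IsSeparated δ f) (hδ : 0 < δ) (N : ℕ) :
    algebraMap ℝ _ (N - 1 / δ) ≤ fourierMatrix f N * (fourierMatrix f N)ᴴ := by
  have hP := star_right_conjugate_le_conjugate (h.hilbertMatrix_le hδ) (phaseMatrix f (N - 1 / 2))
  have hQ := star_right_conjugate_le_conjugate (h.le_hilbertMatrix hδ) (phaseMatrix f (-1 / 2))
  rw [phaseMatrix_mul_algebraMap_mul_star] at hP hQ
  rw [fourierMatrix_mul_conjTranspose (h.injective hδ)]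
  calc algebraMap ℝ _ (N - 1 / δ) = algebraMap ℝ (Matrix ι ι ℂ) (N : ℝ) -
        (1 / 2 : ℝ) • (algebraMap ℝ _ (1 / δ) - algebraMap ℝ _ (-(1 / δ))) := by
        rw [← map_sub, Algebra.smul_def, ← map_mul, ← map_sub]
        ring_nf
    _ ≤ _ := by gcongr

end LargeSieve

section Filter

theorem IsSeparated.exists_polynomial_eval_fourierChar_eq {ι : Type*} [Fintype ι] {f : ι → ℝ}
    {δ : ℝ} (h : IsSeparated δ f) (hδ : 0 < δ) {N : ℕ} (hN : 1 / δ < N) (b : ι → ℂ) :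
    ∃ q : ℂ[X], q.degree < N ∧ (∀ k, q.eval (𝐞 (f k) : ℂ) = b k) ∧
      (N - 1 / δ) * ∑ n ∈ range N, ‖q.coeff n‖ ^ 2 ≤ ∑ k, ‖b k‖ ^ 2 := by
  classical
  obtain ⟨a, ha, hnorm⟩ := exists_mulVec_eq_of_algebraMap_le (sub_pos.2 hN)
    (h.le_fourierMatrix_mul_conjTranspose hδ N) b
  refine ⟨ofFn N a, ofFn_degree_lt a, fun k => ?_, ?_⟩
  · rw [ofFn_eq_sum_monomial, eval_finsetSum, ← congrFun ha k]
    refine sum_congr rfl fun n _ => ?_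
    rw [eval_monomial, mul_comm]
    rfl
  · rw [← Fin.sum_univ_eq_sum_range (fun n => ‖(ofFn N a).coeff n‖ ^ 2)]
    simpa only [ofFn_coeff_eq_val_of_lt a (Fin.is_lt _)] using hnorm

/-- The filter whose taps are the coefficients of `q`: the two-sided sequence with value
`q.coeff n` at `n : ℕ` and `0` at negative integers. -/
noncomputable def coeffSeq (q : ℂ[X]) : ℤ → ℂ :=
  Function.extend (Nat.cast : ℕ → ℤ) q.coeff 0

theorem coeffSeq_natCast (q : ℂ[X]) (n : ℕ) : coeffSeq q n = q.coeff n :=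
  Nat.cast_injective.extend_apply _ _ _

theorem coeffSeq_eq_zero_of_notMem_range {q : ℂ[X]} {t : ℤ}
    (ht : t ∉ Set.range (Nat.cast : ℕ → ℤ)) : coeffSeq q t = 0 :=
  Function.extend_apply' _ _ _ ht

theorem coeffSeq_mem_seqOn {q : ℂ[X]} {m : ℕ} (hq : q.degree < (m + 1 : ℕ)) :
    coeffSeq q ∈ seqOn 0 m := by
  intro t ht
  by_cases hrange : t ∈ Set.range (Nat.cast : ℕ → ℤ)
  · obtain ⟨n, rfl⟩ := hrange
    rw [Set.mem_Icc] at ht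
    rw [coeffSeq_natCast]
    exact coeff_eq_zero_of_degree_lt (hq.trans_le (by norm_cast; omega))
  · exact coeffSeq_eq_zero_of_notMem_range hrange

theorem tsum_eq_sum_range_of_coeffSeq {α : Type*} [AddCommMonoid α] [TopologicalSpace α]
    {q : ℂ[X]} {N : ℕ} (hq : q.degree < N) {g : ℤ → α} (hg : ∀ t, coeffSeq q t = 0 → g t = 0) :
    ∑' t, g t = ∑ n ∈ range N, g n := by
  rw [← (Nat.cast_injective (R := ℤ)).tsum_eq, tsum_eq_sum]
  · intro n hn
    refine hg _ ?_
    rw [coeffSeq_natCast]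
    refine coeff_eq_zero_of_degree_lt (hq.trans_le ?_)
    simpa using hn
  · exact fun t ht => by_contra fun h => ht (hg _ (coeffSeq_eq_zero_of_notMem_range h))

theorem l2norm_coeffSeq {q : ℂ[X]} {N : ℕ} (hq : q.degree < N) :
    l2norm (coeffSeq q) = √(∑ n ∈ range N, ‖q.coeff n‖ ^ 2) := by
  rw [l2norm, tsum_eq_sum_range_of_coeffSeq hq fun t ht => by simp [ht]]
  simp only [coeffSeq_natCast]

theorem conv_coeffSeq (q : ℂ[X]) (x : ℤ → ℂ) : conv (coeffSeq q) x = aeval shift q x := by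
  ext t
  rw [conv, tsum_eq_sum_range_of_coeffSeq (q := q) (degree_le_natDegree.trans_lt
    (WithBot.coe_lt_coe.2 (Nat.lt_succ_self _))) fun t ht => by simp [ht], aeval_eq_sum_range]
  simp [LinearMap.sum_apply, Finset.sum_apply, shift_pow_apply, coeffSeq_natCast]

theorem sub_conv_coeffSeq_eq_zero {p q : ℂ[X]} (h : p ∣ 1 - q) {x : ℤ → ℂ}
    (hx : x ∈ solutionSpace p) (t : ℤ) : x t - conv (coeffSeq q) x t = 0 := by
  obtain ⟨r, hr⟩ := h
  have : aeval shift (1 - q) x = 0 := by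
    rw [hr, mul_comm, map_mul, Module.End.mul_apply, LinearMap.mem_ker.1 hx, map_zero]
  rw [map_sub, map_one] at this
  rw [conv_coeffSeq]
  exact congrFun this t

theorem dvd_of_roots_eq_map_of_forall_isRoot {ι K : Type*} [Fintype ι] [Field K] [IsAlgClosed K]
    {p q : K[X]} {z : ι → K} (hp : p ≠ 0) (hroots : p.roots = univ.val.map z)
    (hz : Function.Injective z) (hq : ∀ i, q.IsRoot (z i)) : p ∣ q := by
  obtain rfl | hq0 := eq_or_ne q 0
  · exact dvd_zero p
  refine (IsAlgClosed.splits p).dvd_of_roots_le_roots hp ?_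
  rw [hroots, Multiset.le_iff_subset ((Multiset.nodup_map_iff_of_injective hz).2 univ.nodup)]
  intro w hw
  obtain ⟨i, -, rfl⟩ := Multiset.mem_map.1 hw
  exact (mem_roots hq0).2 (hq i)

theorem IsSeparated.exists_filter {ι : Type*} [Fintype ι] {m : ℕ} {p : ℂ[X]} {f : ι → ℝ} {δ : ℝ}
    (hp : p ≠ 0) (hroots : p.roots = univ.val.map fun k => (𝐞 (f k) : ℂ))
    (h : IsSeparated δ f) (hδ : 0 < δ) (hm : 1 / δ < m + 1) :
    ∃ φ ∈ seqOn 0 m, (∀ x ∈ solutionSpace p, ∀ t, x t - conv φ x t = 0) ∧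
      l2norm φ ≤ √(Fintype.card ι / (m + 1 - 1 / δ)) := by
  obtain ⟨q, hdeg, heval, hnorm⟩ := h.exists_polynomial_eval_fourierChar_eq hδ (N := m + 1)
    (by exact_mod_cast hm) 1
  have hdvd : p ∣ 1 - q := by
    refine dvd_of_roots_eq_map_of_forall_isRoot hp hroots (fun i j hij => ?_) fun k => ?_
    · exact h.injective hδ (fourierChar_inj.1 (Circle.coe_injective hij))
    · rw [IsRoot.def, eval_sub, eval_one, heval, Pi.one_apply, sub_self]
  refine ⟨coeffSeq q, coeffSeq_mem_seqOn hdeg, fun x hx => sub_conv_coeffSeq_eq_zero hdvd hx, ?_⟩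
  rw [l2norm_coeffSeq hdeg]
  refine Real.sqrt_le_sqrt ((le_div_iff₀' (sub_pos.2 hm)).2 ?_)
  simpa using hnorm

theorem isSeparated_of_le_minSeparation {s : ℕ} {f : Fin s → ℝ} {δ : ℝ}
    (h : ENNReal.ofReal δ ≤ minSeparation f) : IsSeparated δ f := by
  intro i j hij
  rw [← ENNReal.ofReal_le_ofReal_iff dist_nonneg]
  exact h.trans ((iInf₂_le i j).trans (iInf_le _ hij))

theorem div_add_one_sub_div_le {s m w v : ℝ} (hs : 0 ≤ s) (hm : 0 ≤ m) (hw : 1 < w) (hwv : w ≤ v) :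
    s / (m + 1 - m / v) ≤ (w + 1) / (w - 1) * (s / (m + 1)) := by
  have hpos := sub_pos.2 hw
  have hdiv : m / v ≤ m / w := div_le_div_of_nonneg_left hm (by linarith) hwv
  have hle : (m + 1) * ((w - 1) / (w + 1)) ≤ m + 1 - m / w := by
    have : m + 1 - m / w - (m + 1) * ((w - 1) / (w + 1)) =
        (m * (w - 1) + 2 * w) / (w * (w + 1)) := by
      field_simp
      ring
    rw [← sub_nonneg, this]
    positivity
  calc s / (m + 1 - m / v) ≤ s / ((m + 1) * ((w - 1) / (w + 1))) :=
        div_le_div_of_nonneg_left hs (by positivity) (by linarith)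
    _ = (w + 1) / (w - 1) * (s / (m + 1)) := by field_simp

theorem exists_filter_of_le_minSeparation {s m : ℕ} {p : ℂ[X]} {f : Fin s → ℝ} {v : ℝ}
    (hp : p ≠ 0) (hroots : p.roots = univ.val.map fun k => (𝐞 (f k) : ℂ)) (hm : 0 < m)
    (hv : 1 < v) (hsep : ENNReal.ofReal (v / m) ≤ minSeparation f) :
    ∃ φ ∈ seqOn 0 m, (∀ x ∈ solutionSpace p, ∀ t, x t - conv φ x t = 0) ∧
      ∀ w, 1 < w → w ≤ v → l2norm φ ≤ √((w + 1) / (w - 1) * (s / (m + 1))) := by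
  have hm' : (0 : ℝ) < m := Nat.cast_pos.2 hm
  have hlt : 1 / (v / m) < (m + 1 : ℝ) := by
    rw [one_div_div]
    exact (div_le_self hm'.le hv.le).trans_lt (lt_add_one _)
  obtain ⟨φ, hφ, hrep, hnorm⟩ :=
    (isSeparated_of_le_minSeparation hsep).exists_filter hp hroots (by positivity) hlt
  rw [Fintype.card_fin, one_div_div] at hnorm
  exact ⟨φ, hφ, hrep, fun w hw hwv =>
    hnorm.trans (Real.sqrt_le_sqrt (div_add_one_sub_div_le s.cast_nonneg hm'.le hw hwv))⟩

end Filter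

end HarmonicFilter

theorem mainTheorem5 (s m : ℕ) (hs : 0 < s) (hm : 0 < m)
    (p : Polynomial ℂ) (hdeg : p.natDegree = s) (f : Fin s → ℝ)
    (hroots : p.roots =
      Finset.univ.val.map (fun k : Fin s => Complex.exp (2 * Real.pi * Complex.I * f k)))
    (u : ℝ) (hu : 1 < u)
    (hsep : ENNReal.ofReal (u / m) ≤ HarmonicFilter.minSeparation f) :
    ∃ φ : ℤ → ℂ, φ ∈ HarmonicFilter.seqOn 0 m ∧
      (∀ x ∈ HarmonicFilter.solutionSpace p, ∀ t : ℤ, x t - HarmonicFilter.conv φ x t = 0) ∧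
      HarmonicFilter.l2norm φ ≤ Real.sqrt ((u + 1) / (u - 1) * (s / (m + 1))) ∧
      (ENNReal.ofReal (2 / m) ≤ HarmonicFilter.minSeparation f →
        HarmonicFilter.l2norm φ ≤ Real.sqrt (3 * s / (m + 1))) := by
  have hp : p ≠ 0 := ne_zero_of_natDegree_gt (hs.trans_eq hdeg.symm)
  simp_rw [← HarmonicFilter.coe_fourierChar] at hroots
  obtain ⟨v, huv, hv, hv2⟩ : ∃ v, u ≤ v ∧
      ENNReal.ofReal (v / m) ≤ HarmonicFilter.minSeparation f ∧
      (ENNReal.ofReal (2 / m) ≤ HarmonicFilter.minSeparation f → 2 ≤ v) := by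
    by_cases h2 : ENNReal.ofReal (2 / m) ≤ HarmonicFilter.minSeparation f
    · refine ⟨max u 2, le_max_left u 2, ?_, fun _ => le_max_right u 2⟩
      rcases max_choice u 2 with h | h <;> rwa [h]
    · exact ⟨u, le_rfl, hsep, fun h => absurd h h2⟩
  obtain ⟨φ, hφ, hrep, hnorm⟩ :=
    HarmonicFilter.exists_filter_of_le_minSeparation hp hroots hm (hu.trans_le huv) hv
  exact ⟨φ, hφ, hrep, hnorm u hu huv,
    fun h2 => (hnorm 2 one_lt_two (hv2 h2)).trans_eq (by ring_nf)⟩
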